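/- Let $N\ge3$, $p_0,p_1,p_2\in[0,1]$, $q_m=1-p_m$, $0<\gamma<1$, and $E=\{0,1\}^N$, with indices of players $1,\dots,N$ read modulo $N$. For $x\in E$ let $m_i(x)=x_{i-1}+x_{i+1}$, let $x^i$ be $x$ with the $i$th coordinate flipped, and let $x^{i,\pm1}$ be $x$ with $i$th coordinate replaced by $0$ and $(i\pm1)$st coordinate replaced by $1$. Define $$P_{A'}(x,y)=\frac1{2N}\sum_{i=1}^N[\delta(x^{i,-1},y)+\delta(x^{i,1},y)],$$ $$P_B(x,x^i)=\frac1N\begin{cases}p_{m_i(x)}&x_i=0\\ q_{m_i(x)}&x_i=1\end{cases},\qquad P_B(x,x)=\frac1N\Big(\sum_{i:x_i=0}q_{m_i(x)}+\sum_{i:x_i=1}p_{m_i(x)}\Big),$$ all other entries of $P_B$ being $0$. Let $\dot P_B$ be $P_B$ with each $q_m$ replaced by $-q_m$, $\dot P_{A'}=0$, and $P_{C'}=\gamma P_{A'}+(1-\gamma)P_B$, $\dot P_{C'}=\gamma\dot P_{A'}+(1-\gamma)\dot P_B=(1-\gamma)\dot P_B$. Call $x,y\in E$ equivalent if $y=(x_{\sigma(1)},\dots,x_{\sigma(N)})$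 for some $\sigma$ in the dihedral group generated by the rotations and reflections of the players, and let $\bar E$ be the set of equivalence classes. Then $P_{A'}$, $P_B$ and $\dot P_B$ are lumpable: for each of these matrices $Q$, the sum $\bar Q([x],[y]):=\sum_{y'\in[y]}Q(x,y')$ depends only on $[x]$ and $[y]$. Let $\bar P_{C'}=\gamma\bar P_{A'}+(1-\gamma)\bar P_B$ and $\dot{\bar P}_{C'}=(1-\gamma)\dot{\bar P}_B$. Game $C'$ is played as follows. At each turn, independently of the past, with probability $\gamma$ game $A'$ is played (a uniformly chosen player loses one unit and a uniformly chosen one of his two nearest neighbors wins one unit), and with probability $1-\gamma$ game $B$ is played (a uniformly chosen player $i$ tosses a coin with heads probability $p_{m_i(x)}$, where $x$ is the current state, and wins one unit with heads, loses one unit with tails). The state $x$ records the result of the most recent game of each player ($1$ win, $0$ loss), its initial value being arbitrary. Let $W_k$ be the total profit of all players at the $k$th turn. Then $P_{C'}$ and $\bar P_{C'}$ have unique stationary distributions $\pi_{C'}$ and $\bar\pi_{C'}$, and the game has an equilibrium mean profit per turn $\mu_{C'}$: the game can be realized with every initial distribution on $E$; for every initial distribution, $\frac1n\sum_{k=1}^nW_k\to\mu_{C'}$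 almost surely; and if the state process is started in equilibrium (the distribution of the state is the same after every number of turns), then $\mathbb E[W_k]=\mu_{C'}$ for all $k$. Moreover, $$\mu_{C'}=\pi_{C'}\dot P_{C'}\mathbf 1=\bar\pi_{C'}\dot{\bar P}_{C'}\mathbf 1 .$$ -/

import Mathlib

open MeasureTheory Filter Topology Matrix

namespace Parrondo

/-- Statuses of the `N` players on a circle: `1` for a winner, `0` for a loser. The players
`1, …, N` are the residues modulo `N`, so the neighbours of player `i` are `i - 1` and `i + 1`. -/
abbrev State (N : ℕ) : Type := ZMod N → Fin 2

/-- The number of winners among the two nearest neighbours of player `i`. -/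
def winners {N : ℕ} (x : State N) (i : ZMod N) : Fin 3 :=
  ⟨(x (i - 1) : ℕ) + (x (i + 1) : ℕ), by omega⟩

/-- The state `x` with the status of player `i` flipped. -/
def flip {N : ℕ} (x : State N) (i : ZMod N) : State N :=
  Function.update x i (1 - x i)

/-- Player `i` loses and his neighbour `j` wins (a play of game `A'`). -/
def transfer {N : ℕ} (x : State N) (i j : ZMod N) : State N :=
  Function.update (Function.update x i 0) j 1

section Chains

variable (N : ℕ) [NeZero N]

/-- Transition matrix of game `A'`. -/
noncomputable def matA : Matrix (State N) (State N) ℝ := fun x y =>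
  (2 * (N : ℝ))⁻¹ * ∑ i : ZMod N,
    ((if transfer x i (i - 1) = y then 1 else 0) + (if transfer x i (i + 1) = y then 1 else 0))

/-- The matrix of game `B` as an expression in independent symbols `p` and `q`. -/
noncomputable def matBpq (p q : Fin 3 → ℝ) : Matrix (State N) (State N) ℝ := fun x y =>
  (N : ℝ)⁻¹ *
    ((∑ i : ZMod N, if flip x i = y then
        (if x i = 0 then p (winners x i) else q (winners x i)) else 0) +
      (if x = y then
        ∑ i : ZMod N, (if x i = 0 then q (winners x i) else p (winners x i)) else 0))

/-- Transition matrix of game `B`. -/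
noncomputable def matB (p : Fin 3 → ℝ) : Matrix (State N) (State N) ℝ :=
  matBpq N p (fun m => 1 - p m)

/-- The matrix of game `B` with `q m = 1 - p m` replaced by `-q m`. -/
noncomputable def dotB (p : Fin 3 → ℝ) : Matrix (State N) (State N) ℝ :=
  matBpq N p (fun m => -(1 - p m))

/-- Every play of game `A'` gives profit `-1 + 1 = 0` to the ensemble of players. -/
def dotA : Matrix (State N) (State N) ℝ := 0

/-- Transition matrix of game `C' = γ A' + (1 - γ) B`. -/
noncomputable def matC (p : Fin 3 → ℝ) (γ : ℝ) : Matrix (State N) (State N) ℝ :=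
  γ • matA N + (1 - γ) • matB N p

/-- Profit matrix of game `C'`. -/
noncomputable def dotC (p : Fin 3 → ℝ) (γ : ℝ) : Matrix (State N) (State N) ℝ :=
  γ • dotA N + (1 - γ) • dotB N p

end Chains

/-! Dihedral reduction -/

/-- The dihedral group of permutations of the players, generated by the rotation `i ↦ i + 1` and
the reflection `i ↦ 1 - i` (that is, `i ↦ N + 1 - i`). -/
def dihedral (N : ℕ) : Subgroup (Equiv.Perm (ZMod N)) :=
  Subgroup.closure {Equiv.addRight 1, Equiv.subLeft 1}

/-- States are equivalent when they differ by a dihedral permutation of the players. -/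
def dihedralSetoid (N : ℕ) : Setoid (State N) where
  r x y := ∃ σ ∈ dihedral N, y = x ∘ σ
  iseqv :=
    { refl := fun x => ⟨1, one_mem _, rfl⟩
      symm := by
        rintro x y ⟨σ, hσ, rfl⟩
        exact ⟨σ⁻¹, inv_mem hσ, by ext i; simp⟩
      trans := by
        rintro x y z ⟨σ, hσ, rfl⟩ ⟨τ, hτ, rfl⟩
        exact ⟨σ * τ, mul_mem hσ hτ, rfl⟩ }

/-- The reduced state space: the set of equivalence classes. -/
abbrev RState (N : ℕ) : Type := Quotient (dihedralSetoid N)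

noncomputable instance (N : ℕ) [NeZero N] : Fintype (RState N) := Fintype.ofFinite _

open Classical in
/-- Sum of the entries of row `x` over an equivalence class. -/
noncomputable def classSum {N : ℕ} [NeZero N] (P : Matrix (State N) (State N) ℝ)
    (x : State N) (b : RState N) : ℝ :=
  ∑ y with Quotient.mk (dihedralSetoid N) y = b, P x y

/-- Lumpability with respect to the dihedral equivalence. -/
def IsLumpable {N : ℕ} [NeZero N] (P : Matrix (State N) (State N) ℝ) : Prop :=
  ∀ x x' : State N, dihedralSetoid N x x' → ∀ b : RState N, classSum P x b = classSum P x' b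

/-- The reduced matrix `([x], [y]) ↦ ∑ y' ∈ [y], P x y'`; for a lumpable matrix the chosen
representative of `[x]` is immaterial. -/
noncomputable def reduced {N : ℕ} [NeZero N] (P : Matrix (State N) (State N) ℝ) :
    Matrix (RState N) (RState N) ℝ :=
  fun a b => classSum P a.out b

/-- Reduced transition matrix of game `C'`. -/
noncomputable def matCbar (N : ℕ) [NeZero N] (p : Fin 3 → ℝ) (γ : ℝ) :
    Matrix (RState N) (RState N) ℝ :=
  γ • reduced (matA N) + (1 - γ) • reduced (matB N p)

/-- Reduced profit matrix of game `C'`. -/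
noncomputable def dotCbar (N : ℕ) [NeZero N] (p : Fin 3 → ℝ) (γ : ℝ) :
    Matrix (RState N) (RState N) ℝ :=
  γ • reduced (dotA N) + (1 - γ) • reduced (dotB N p)

/-- `π` is a stationary distribution of `P`. -/
def IsStationary {S : Type*} [Fintype S] (P : Matrix S S ℝ) (π : S → ℝ) : Prop :=
  π ∈ stdSimplex ℝ S ∧ π ᵥ* P = π

/-- `π` is the unique stationary distribution of `P`. -/
def IsUniqueStationary {S : Type*} [Fintype S] (P : Matrix S S ℝ) (π : S → ℝ) : Prop :=
  IsStationary P π ∧ ∀ π', IsStationary P π' → π' = π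

/-! The game itself -/

/-- The probability that one turn of game `C'` from state `x` leads to state `y` with total profit
`w`. With probability `γ` game `A'` is played: a uniformly chosen player loses one unit and a
uniformly chosen neighbour of his wins one. Otherwise game `B` is played: a uniformly chosen
player `i` tosses a coin with heads probability `p m`, where `m` is the number of winners among
his neighbours; he wins one unit with heads and loses one unit with tails. -/
noncomputable def turnProb {N : ℕ} [NeZero N] (p : Fin 3 → ℝ) (γ : ℝ)
    (x y : State N) (w : ℤ) : ℝ :=
  γ * ∑ i : ZMod N, (N : ℝ)⁻¹ *
      ((1 / 2) * (if y = transfer x i (i - 1) ∧ w = -1 + 1 then 1 else 0) +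
        (1 / 2) * (if y = transfer x i (i + 1) ∧ w = -1 + 1 then 1 else 0)) +
  (1 - γ) * ∑ i : ZMod N, (N : ℝ)⁻¹ *
      (p (winners x i) * (if y = Function.update x i 1 ∧ w = 1 then 1 else 0) +
        (1 - p (winners x i)) * (if y = Function.update x i 0 ∧ w = -1 then 1 else 0))

/-- A play of game `C'`, with any initial distribution: `X n` is the state after `n` turns and
`W n` is the profit of the turn that leads from `X n` to `X (n + 1)`. Given the whole past, a turn
has the distribution `turnProb`. -/
structure IsPlay {N : ℕ} [NeZero N] (p : Fin 3 → ℝ) (γ : ℝ) {Ω : Type*} [MeasurableSpace Ω]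
    (P : Measure Ω) (X : ℕ → Ω → State N) (W : ℕ → Ω → ℤ) : Prop where
  measurable_state : ∀ n, Measurable (X n)
  measurable_profit : ∀ n, Measurable (W n)
  turn : ∀ (n : ℕ) (x : ℕ → State N) (w : ℕ → ℤ),
    P.real {ω | (∀ k ≤ n + 1, X k ω = x k) ∧ ∀ k < n + 1, W k ω = w k} =
      P.real {ω | (∀ k ≤ n, X k ω = x k) ∧ ∀ k < n, W k ω = w k} *
        turnProb p γ (x n) (x (n + 1)) (w n)

/-- `μ` is the equilibrium mean profit per turn in game `C'`: the game can be started from any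
initial distribution, the profit per turn over the first `n` turns converges to `μ` almost surely
in every play, and `μ` is the expected profit of each turn in a play that is in equilibrium. -/
structure IsMeanProfit (N : ℕ) [NeZero N] (p : Fin 3 → ℝ) (γ μ : ℝ) : Prop where
  exists_play : ∀ ν ∈ stdSimplex ℝ (State N), ∃ (Ω : Type) (_ : MeasurableSpace Ω)
    (P : Measure Ω) (_ : IsProbabilityMeasure P) (X : ℕ → Ω → State N) (W : ℕ → Ω → ℤ),
    IsPlay p γ P X W ∧ ∀ x, P.real {ω | X 0 ω = x} = ν x
  tendsto : ∀ (Ω : Type) [MeasurableSpace Ω] (P : Measure Ω) [IsProbabilityMeasure P]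
    (X : ℕ → Ω → State N) (W : ℕ → Ω → ℤ), IsPlay p γ P X W →
    ∀ᵐ ω ∂P, Tendsto (fun n : ℕ => (∑ k ∈ Finset.range n, (W k ω : ℝ)) / n) atTop (𝓝 μ)
  equilibrium : ∀ (Ω : Type) [MeasurableSpace Ω] (P : Measure Ω) [IsProbabilityMeasure P]
    (X : ℕ → Ω → State N) (W : ℕ → Ω → ℤ), IsPlay p γ P X W →
    (∀ n x, P.real {ω | X n ω = x} = P.real {ω | X 0 ω = x}) →
    ∀ n, Integrable (fun ω => (W n ω : ℝ)) P ∧ ∫ ω, (W n ω : ℝ) ∂P = μ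

end Parrondo

/-!
The transition matrix `matC` is stochastic, and since game `A'` is played with positive probability,
the state in which player `N - 1` is the only winner is reachable from every state: player `0` loses
to player `1`, then player `1` to player `2`, and so on around the circle (`matC_reachable`). For a
finite stochastic matrix `P` with a state `z` reachable from everywhere, a vector `v` with
`v P = v` and `v z = 0` vanishes, because `|v|` is again invariant and its support is closed under
transitions. So the left fixed vectors form a line, which gives existence and uniqueness of the
stationary distribution (`exists_isStationary`, `IsStationary.eq`) and solvability of the Poisson
equation `g - P g = f - π f` (`exists_poisson`).

The matrices of the games are invariant under simultaneous dihedral permutations of rows and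
columns, hence lumpable. Stochasticity and reachability pass to the reduced matrix, the image of
`π` on equivalence classes is stationary for it, and integrating a function of the class gives the
same result before and after the reduction; this is the equality of the two formulas for the mean.

The profit matrix `dotC` is the transition matrix weighted by the profit of the turn
(`sum_cast_mul_turnProb`), so `dotC *ᵥ 1` is the expected profit of a turn as a function of the
state. In equilibrium the law of the state is `π`, which gives the expectation of the profit. For
the almost sure limit, let `g` solve the Poisson equation for `f = dotC *ᵥ 1`. Then
`W n - μ + g (X (n + 1)) - g (X n)` is a bounded sequence with mean zero given the history
(`IsPlay.map_hist_next` disintegrates the law of a play along its countable set of histories). The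
fourth moment of the sum of `n` such terms is `O(n ^ 2)`, so the averages tend to zero
(`ae_tendsto_sum_div_of_integral_mul_eq_zero`), and the `g`-terms telescope.

Plays are constructed from independent instructions, one for each time and state, by following at
each time the instruction for the current state (`exists_isPlay`).
-/

namespace Parrondo

open scoped ProbabilityTheory

/-! ### Finite Markov chains with a state that is reachable from everywhere -/

section FiniteChain

variable {S : Type*} [Fintype S] [DecidableEq S] {P : Matrix S S ℝ}

/-- The triangle inequality gives `|v| ≤ |v| P`, and both sides have the same total mass. -/
lemma abs_vecMul_eq_of_vecMul_eq (hP : P ∈ rowStochastic ℝ S) {v : S → ℝ} (hv : v ᵥ* P = v) :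
    |v| ᵥ* P = |v| := by
  have hle : ∀ y, |v| y ≤ (|v| ᵥ* P) y := fun y => by
    have h : v y = ∑ x, v x * P x y := by
      conv_lhs => rw [← hv]
      rfl
    calc |v y| = |∑ x, v x * P x y| := by rw [← h]
      _ ≤ ∑ x, |v x * P x y| := Finset.abs_sum_le_sum_abs _ _
      _ = ∑ x, |v| x * P x y := by
        simp [abs_mul, abs_of_nonneg (nonneg_of_mem_rowStochastic hP)]
  have hsum : ∑ y, |v| y = ∑ y, (|v| ᵥ* P) y := by
    simp only [vecMul, dotProduct]
    rw [Finset.sum_comm]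
    simp [← Finset.mul_sum, sum_row_of_mem_rowStochastic hP]
  funext y
  exact ((Finset.sum_eq_sum_iff_of_le fun y _ => hle y).1 hsum y (Finset.mem_univ y)).symm

/-- The support of a nonnegative invariant vector is closed under transitions of positive
probability, hence contains `z` unless it is empty. -/
lemma eq_zero_of_vecMul_eq_of_apply_eq_zero (hP : P ∈ rowStochastic ℝ S) {z : S}
    (hz : ∀ x, Relation.ReflTransGen (fun a b => 0 < P a b) x z) {v : S → ℝ} (hv : v ᵥ* P = v)
    (h0 : v z = 0) : v = 0 := by
  have habs := abs_vecMul_eq_of_vecMul_eq hP hv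
  funext x
  induction hz x using Relation.ReflTransGen.head_induction_on with
  | refl => exact h0
  | @head a b hab _ ih =>
    have hb : ∑ x, |v x| * P x b = 0 := by
      have := congrFun habs b
      simpa [vecMul, dotProduct, ih] using this
    have ha := (Finset.sum_eq_zero_iff_of_nonneg fun x _ =>
      mul_nonneg (abs_nonneg (v x)) (nonneg_of_mem_rowStochastic hP)).1 hb a (Finset.mem_univ a)
    simpa [hab.ne'] using ha

/-- The space of left fixed vectors is at most one-dimensional. -/
lemma vecMul_eq_smul_of_vecMul_eq (hP : P ∈ rowStochastic ℝ S) {z : S}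
    (hz : ∀ x, Relation.ReflTransGen (fun a b => 0 < P a b) x z) {v w : S → ℝ}
    (hv : v ᵥ* P = v) (hw : w ᵥ* P = w) : w z • v = v z • w := by
  rw [← sub_eq_zero]
  apply eq_zero_of_vecMul_eq_of_apply_eq_zero hP hz
  · rw [sub_vecMul, smul_vecMul, smul_vecMul, hv, hw]
  · simp [mul_comm]

lemma IsStationary.eq (hP : P ∈ rowStochastic ℝ S) {z : S}
    (hz : ∀ x, Relation.ReflTransGen (fun a b => 0 < P a b) x z) {v w : S → ℝ}
    (hv : IsStationary P v) (hw : IsStationary P w) : v = w := by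
  have h := vecMul_eq_smul_of_vecMul_eq hP hz hv.2 hw.2
  have hsum : w z = v z := by
    have := congrArg (fun u : S → ℝ => ∑ x, u x) h
    simpa [← Finset.mul_sum, hv.1.2, hw.1.2] using this
  have hne : v z ≠ 0 := fun h0 => by
    have := hv.1.2
    simp [eq_zero_of_vecMul_eq_of_apply_eq_zero hP hz hv.2 h0] at this
  rw [hsum] at h
  exact smul_right_injective _ hne h

/-- `1 - P` is singular because it annihilates constants from the right, so it annihilates some
`v ≠ 0` from the left; `|v|`, normalized, is stationary. -/
lemma exists_isStationary [Nonempty S] (hP : P ∈ rowStochastic ℝ S) : ∃ π, IsStationary P π := by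
  obtain ⟨v, hv0, hv⟩ : ∃ v ≠ 0, v ᵥ* (1 - P) = 0 := by
    rw [exists_vecMul_eq_zero_iff, ← exists_mulVec_eq_zero_iff]
    exact ⟨1, one_ne_zero, by rw [sub_mulVec, one_mulVec, one_vecMul_of_mem_rowStochastic hP,
      sub_self]⟩
  have hv' : v ᵥ* P = v := by
    rw [vecMul_sub, vecMul_one, sub_eq_zero] at hv
    exact hv.symm
  have habs := abs_vecMul_eq_of_vecMul_eq hP hv'
  have hpos : 0 < ∑ x, |v| x := by
    obtain ⟨x, hx⟩ := Function.ne_iff.1 hv0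
    exact Finset.sum_pos' (fun x _ => abs_nonneg (v x)) ⟨x, Finset.mem_univ x, abs_pos.2 hx⟩
  refine ⟨(∑ x, |v| x)⁻¹ • |v|, ⟨fun x => ?_, ?_⟩, ?_⟩
  · exact mul_nonneg (inv_nonneg.2 hpos.le) (abs_nonneg (v x))
  · simp only [Pi.smul_apply, smul_eq_mul, ← Finset.mul_sum]
    exact inv_mul_cancel₀ hpos.ne'
  · rw [smul_vecMul, habs]

/-- Solvability of the Poisson equation `h - P h = f - π f`: the matrix `1 - P + 𝟏 π` is
invertible because the only vectors fixed by `P` from the left are the multiples of `π`. -/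
lemma exists_poisson (hP : P ∈ rowStochastic ℝ S) {z : S}
    (hz : ∀ x, Relation.ReflTransGen (fun a b => 0 < P a b) x z) {π : S → ℝ}
    (hπ : IsStationary P π) (f : S → ℝ) : ∃ h : S → ℝ, h - P *ᵥ h = f - (π ⬝ᵥ f) • 1 := by
  have h1 : P *ᵥ 1 = 1 := one_vecMul_of_mem_rowStochastic hP
  have hπ1 : π ⬝ᵥ 1 = 1 := by simpa [dotProduct] using hπ.1.2
  have hunit : IsUnit (1 - P + vecMulVec 1 π) := by
    rw [← vecMul_injective_iff_isUnit]
    refine (injective_iff_map_eq_zero (vecMulLinear (1 - P + vecMulVec 1 π))).2 fun v hv => ?_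
    have hv' : v - v ᵥ* P + (v ⬝ᵥ 1) • π = 0 := by
      rw [vecMulLinear_apply, vecMul_add, vecMul_sub, vecMul_one, vecMul_vecMulVec] at hv
      exact hv
    have hsum : v ⬝ᵥ 1 = 0 := by
      have := congrArg (· ⬝ᵥ (1 : S → ℝ)) hv'
      simpa [add_dotProduct, sub_dotProduct, ← dotProduct_mulVec, h1, hπ1] using this
    have hinv : v ᵥ* P = v := by
      rw [hsum, zero_smul, add_zero, sub_eq_zero] at hv'
      exact hv'.symm
    have hprop := vecMul_eq_smul_of_vecMul_eq hP hz hinv hπ.2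
    have hvz : v z = 0 := by
      have := congrArg (· ⬝ᵥ (1 : S → ℝ)) hprop
      simpa [hsum, hπ1] using this.symm
    exact eq_zero_of_vecMul_eq_of_apply_eq_zero hP hz hinv hvz
  obtain ⟨h, hh⟩ := mulVec_surjective_iff_isUnit.2 hunit (f - (π ⬝ᵥ f) • 1)
  have hh' : h - P *ᵥ h + (π ⬝ᵥ h) • 1 = f - (π ⬝ᵥ f) • 1 := by
    rw [← hh, add_mulVec, sub_mulVec, one_mulVec]
    congr 1
    funext i
    simp [vecMulVec, mulVec, dotProduct]
  have hπh : π ⬝ᵥ h = 0 := by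
    have := congrArg (π ⬝ᵥ ·) hh'
    simpa [dotProduct_add, dotProduct_sub, dotProduct_mulVec, hπ.2, hπ1] using this
  exact ⟨h, by simpa [hπh] using hh'⟩

end FiniteChain

/-! ### The transition and profit matrices of the games -/

section Matrices

variable {N : ℕ} [NeZero N]

/-- Row `x` of the matrix of game `B` as a sum over the player who tosses the coin: player `i`
becomes a winner or a loser, whatever his previous status was. -/
lemma matBpq_apply (p q : Fin 3 → ℝ) (x y : State N) :
    matBpq N p q x y = (N : ℝ)⁻¹ * ∑ i : ZMod N,
      (p (winners x i) * (if y = Function.update x i 1 then 1 else 0) +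
        q (winners x i) * (if y = Function.update x i 0 then 1 else 0)) := by
  unfold matBpq
  congr 1
  have h : (if x = y then
      ∑ i : ZMod N, (if x i = 0 then q (winners x i) else p (winners x i)) else 0) =
      ∑ i : ZMod N, if x = y then
        (if x i = 0 then q (winners x i) else p (winners x i)) else 0 := by
    split_ifs <;> simp
  rw [h, ← Finset.sum_add_distrib]
  refine Finset.sum_congr rfl fun i _ => ?_
  have hself : Function.update x i (x i) = x := Function.update_eq_self i x
  obtain hi | hi : x i = 0 ∨ x i = 1 := by omega
  · rw [hi] at hself
    simp only [flip, hi, hself, sub_zero, eq_comm (a := y), if_true]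
    simp
  · rw [hi] at hself
    simp only [flip, hi, hself, sub_self, eq_comm (a := y)]
    simp [add_comm]

lemma sum_matA (x : State N) : ∑ y, matA N x y = 1 := by
  have hN : (N : ℝ) ≠ 0 := NeZero.ne _
  simp only [matA, ← Finset.mul_sum]
  rw [Finset.sum_comm]
  simp only [Finset.sum_add_distrib, Finset.sum_ite_eq, Finset.mem_univ, if_true,
    Finset.sum_const, Finset.card_univ, ZMod.card]
  simp
  field_simp
  norm_num

lemma matA_nonneg (x y : State N) : 0 ≤ matA N x y := by
  unfold matA
  positivity

lemma sum_matB (p : Fin 3 → ℝ) (x : State N) : ∑ y, matB N p x y = 1 := by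
  have hN : (N : ℝ) ≠ 0 := NeZero.ne _
  simp only [matB, matBpq_apply, ← Finset.mul_sum]
  rw [Finset.sum_comm]
  simp [Finset.sum_add_distrib, hN, ZMod.card]

lemma matB_nonneg {p : Fin 3 → ℝ} (hp : ∀ m, p m ∈ Set.Icc (0 : ℝ) 1) (x y : State N) :
    0 ≤ matB N p x y := by
  rw [matB, matBpq_apply]
  have h0 := fun m => (hp m).1
  have h1 := fun m => sub_nonneg.2 (hp m).2
  refine mul_nonneg (by positivity) (Finset.sum_nonneg fun i _ => ?_)
  exact add_nonneg (mul_nonneg (h0 _) (by positivity)) (mul_nonneg (h1 _) (by positivity))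

lemma matC_mem_rowStochastic {p : Fin 3 → ℝ} (hp : ∀ m, p m ∈ Set.Icc (0 : ℝ) 1) {γ : ℝ}
    (hγ : γ ∈ Set.Ioo (0 : ℝ) 1) : matC N p γ ∈ rowStochastic ℝ (State N) := by
  rw [mem_rowStochastic_iff_sum]
  refine ⟨fun x y => ?_, fun x => ?_⟩
  · exact add_nonneg (mul_nonneg hγ.1.le (matA_nonneg x y))
      (mul_nonneg (sub_nonneg.2 hγ.2.le) (matB_nonneg hp x y))
  · simp [matC, Finset.sum_add_distrib, ← Finset.mul_sum, sum_matA, sum_matB]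

lemma matC_transfer_pos {p : Fin 3 → ℝ} (hp : ∀ m, p m ∈ Set.Icc (0 : ℝ) 1) {γ : ℝ}
    (hγ : γ ∈ Set.Ioo (0 : ℝ) 1) (x : State N) (i : ZMod N) :
    0 < matC N p γ x (transfer x i (i + 1)) := by
  have hN : (0 : ℝ) < N := Nat.cast_pos.2 (NeZero.pos N)
  refine add_pos_of_pos_of_nonneg (mul_pos hγ.1 ?_)
    (mul_nonneg (sub_nonneg.2 hγ.2.le) (matB_nonneg hp _ _))
  refine mul_pos (by positivity) (Finset.sum_pos' (fun j _ => by positivity) ⟨i, by simp, ?_⟩)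
  rw [if_pos rfl]
  positivity

/-- Game `A'` alone can concentrate everything in player `N - 1`: he wins after each player
`k = 0, …, N - 2` in turn has lost to player `k + 1`. -/
lemma matC_reachable {p : Fin 3 → ℝ} (hp : ∀ m, p m ∈ Set.Icc (0 : ℝ) 1) {γ : ℝ}
    (hγ : γ ∈ Set.Ioo (0 : ℝ) 1) (hN : 2 ≤ N) (x : State N) :
    Relation.ReflTransGen (fun a b => 0 < matC N p γ a b) x
      (Pi.single ((N - 1 : ℕ) : ZMod N) 1) := by
  have cast_ne : ∀ {j k : ℕ}, j < k → k < N → (j : ZMod N) ≠ k := fun hjk hk h => by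
    rw [ZMod.natCast_eq_natCast_iff', Nat.mod_eq_of_lt (hjk.trans hk), Nat.mod_eq_of_lt hk] at h
    exact hjk.ne h
  have key : ∀ k : ℕ, k + 1 < N → ∃ y : State N,
      Relation.ReflTransGen (fun a b => 0 < matC N p γ a b) x y ∧
      (∀ j < k + 1, y (j : ZMod N) = 0) ∧ y ((k + 1 : ℕ) : ZMod N) = 1 := by
    intro k
    induction k with
    | zero =>
      intro hk
      refine ⟨_, .single (matC_transfer_pos hp hγ x 0), fun j hj => ?_, by simp [transfer]⟩
      have h01 : (0 : ZMod N) ≠ 1 := by simpa using cast_ne (Nat.zero_lt_one) hk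
      obtain rfl : j = 0 := by omega
      simp [transfer, h01]
    | succ k ih =>
      intro hk
      obtain ⟨y, hxy, h0, -⟩ := ih (by omega)
      refine ⟨_, hxy.tail (matC_transfer_pos hp hγ y ((k + 1 : ℕ) : ZMod N)), fun j hj => ?_,
        by simp [transfer]⟩
      have hne : (j : ZMod N) ≠ ((k + 1 : ℕ) : ZMod N) + 1 := by
        rw [← Nat.cast_succ]
        exact cast_ne hj hk
      rw [transfer, Function.update_of_ne hne]
      obtain hj' | rfl : j < k + 1 ∨ j = k + 1 := by omega
      · rw [Function.update_of_ne (cast_ne hj' (by omega)), h0 j hj']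
      · simp
  obtain ⟨y, hxy, h0, h1⟩ := key (N - 2) (by omega)
  convert hxy
  have hN' : N - 2 + 1 = N - 1 := by omega
  rw [hN'] at h0 h1
  funext i
  rw [← ZMod.natCast_zmod_val i]
  have hlt := ZMod.val_lt i
  obtain hi | hi : i.val < N - 1 ∨ i.val = N - 1 := by omega
  · rw [h0 _ hi, Pi.single_eq_of_ne (cast_ne hi (by omega))]
  · rw [hi, h1, Pi.single_eq_same]

end Matrices

/-! ### Dihedral symmetry and lumping -/

section Lumping

variable {N : ℕ}

/-- A permutation of the players in the dihedral group maps the two neighbours of a player to the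
two neighbours of his image, in the same or in the opposite order. -/
lemma dihedral_neighbors {σ : Equiv.Perm (ZMod N)} (hσ : σ ∈ dihedral N) :
    (∀ i, σ (i - 1) = σ i - 1 ∧ σ (i + 1) = σ i + 1) ∨
      ∀ i, σ (i - 1) = σ i + 1 ∧ σ (i + 1) = σ i - 1 := by
  induction hσ using Subgroup.closure_induction with
  | mem σ h =>
    obtain rfl | rfl := h
    · left
      intro i
      simp
    · right
      intro i
      simp only [Equiv.subLeft_apply]
      constructor <;> ring
  | one => exact Or.inl fun i => ⟨rfl, rfl⟩
  | mul σ τ _ _ hσ hτ =>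
    simp only [Equiv.Perm.mul_apply]
    rcases hσ with hσ | hσ <;> rcases hτ with hτ | hτ
    · exact Or.inl fun i => by rw [(hτ i).1, (hτ i).2]; exact hσ _
    · exact Or.inr fun i => by rw [(hτ i).1, (hτ i).2]; exact (hσ _).symm
    · exact Or.inr fun i => by rw [(hτ i).1, (hτ i).2]; exact hσ _
    · exact Or.inl fun i => by rw [(hτ i).1, (hτ i).2]; exact (hσ _).symm
  | inv σ _ hσ =>
    simp only [Equiv.Perm.inv_eq_iff_eq]
    rcases hσ with hσ | hσ
    · exact Or.inl fun i => by rw [(hσ _).1, (hσ _).2]; simp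
    · exact Or.inr fun i => by rw [(hσ _).1, (hσ _).2]; simp

lemma winners_comp {σ : Equiv.Perm (ZMod N)} (hσ : σ ∈ dihedral N) (x : State N) (i : ZMod N) :
    winners (x ∘ σ) i = winners x (σ i) := by
  rcases dihedral_neighbors hσ with h | h <;> ext <;>
    simp [winners, (h i).1, (h i).2, add_comm]

lemma update_comp_perm (σ : Equiv.Perm (ZMod N)) (x : State N) (i : ZMod N) (a : Fin 2) :
    Function.update (x ∘ σ) i a = Function.update x (σ i) a ∘ σ := by
  rw [Function.update_comp_equiv, Equiv.symm_apply_apply]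

lemma transfer_comp_perm (σ : Equiv.Perm (ZMod N)) (x : State N) (i j : ZMod N) :
    transfer (x ∘ σ) i j = transfer x (σ i) (σ j) ∘ σ := by
  simp only [transfer, update_comp_perm]

variable [NeZero N]

lemma matBpq_comp {σ : Equiv.Perm (ZMod N)} (hσ : σ ∈ dihedral N) (p q : Fin 3 → ℝ)
    (x y : State N) : matBpq N p q (x ∘ σ) (y ∘ σ) = matBpq N p q x y := by
  simp only [matBpq_apply, winners_comp hσ, update_comp_perm,
    σ.surjective.injective_comp_right.eq_iff]
  congr 1
  exact Equiv.sum_comp σ fun i =>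
    p (winners x i) * (if y = Function.update x i 1 then 1 else 0) +
      q (winners x i) * (if y = Function.update x i 0 then 1 else 0)

lemma matA_comp {σ : Equiv.Perm (ZMod N)} (hσ : σ ∈ dihedral N)
    (x y : State N) : matA N (x ∘ σ) (y ∘ σ) = matA N x y := by
  simp only [matA, transfer_comp_perm, σ.surjective.injective_comp_right.eq_iff]
  congr 1
  rw [← Equiv.sum_comp σ fun i => ((if transfer x i (i - 1) = y then (1 : ℝ) else 0) +
    (if transfer x i (i + 1) = y then 1 else 0))]
  refine Finset.sum_congr rfl fun i _ => ?_
  rcases dihedral_neighbors hσ with h | h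
  · rw [(h i).1, (h i).2]
  · rw [(h i).1, (h i).2, add_comm]

/-- A matrix that is invariant under a simultaneous dihedral permutation of rows and columns is
lumpable. -/
lemma isLumpable_of_comp {Q : Matrix (State N) (State N) ℝ}
    (h : ∀ σ ∈ dihedral N, ∀ x y : State N, Q (x ∘ σ) (y ∘ σ) = Q x y) : IsLumpable Q := by
  rintro x _ ⟨σ, hσ, rfl⟩ b
  unfold classSum
  refine Finset.sum_equiv (σ.symm.arrowCongr (Equiv.refl _)) (fun y => ?_) fun y _ => ?_
  · have hy : (Quotient.mk (dihedralSetoid N) (y ∘ σ)) = Quotient.mk _ y :=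
      (Quotient.sound ⟨σ, hσ, rfl⟩ : Quotient.mk (dihedralSetoid N) y = _).symm
    change _ ↔ y ∘ σ ∈ _
    simp [hy]
  · exact (h σ hσ x y).symm

lemma isLumpable_matA : IsLumpable (matA N) := isLumpable_of_comp fun _ hσ => matA_comp hσ

lemma isLumpable_matBpq (p q : Fin 3 → ℝ) : IsLumpable (matBpq N p q) :=
  isLumpable_of_comp fun _ hσ => matBpq_comp hσ p q

lemma classSum_lincomb (a b : ℝ) (Q R : Matrix (State N) (State N) ℝ) (x : State N)
    (c : RState N) :
    classSum (a • Q + b • R) x c = a * classSum Q x c + b * classSum R x c := by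
  simp [classSum, Finset.sum_add_distrib, Finset.mul_sum]

lemma IsLumpable.lincomb {Q R : Matrix (State N) (State N) ℝ} (hQ : IsLumpable Q)
    (hR : IsLumpable R) (a b : ℝ) : IsLumpable (a • Q + b • R) := fun x x' h c => by
  rw [classSum_lincomb, classSum_lincomb, hQ x x' h, hR x x' h]

lemma reduced_lincomb (a b : ℝ) (Q R : Matrix (State N) (State N) ℝ) :
    reduced (a • Q + b • R) = a • reduced Q + b • reduced R := by
  ext c d
  exact classSum_lincomb a b Q R c.out d

lemma IsLumpable.reduced_mk {Q : Matrix (State N) (State N) ℝ} (hQ : IsLumpable Q) (x : State N)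
    (b : RState N) : reduced Q (Quotient.mk _ x) b = classSum Q x b :=
  hQ _ _ (Quotient.mk_out x) b

/-- Integrating a function of the class over a row of `Q`. -/
lemma sum_classSum_mul (Q : Matrix (State N) (State N) ℝ) (x : State N) (g : RState N → ℝ) :
    ∑ b, classSum Q x b * g b = ∑ y, Q x y * g (Quotient.mk _ y) := by
  classical
  rw [← Finset.sum_fiberwise Finset.univ (Quotient.mk (dihedralSetoid N))]
  refine Finset.sum_congr rfl fun b _ => ?_
  rw [classSum, Finset.sum_mul]
  refine Finset.sum_congr (by congr) fun y hy => ?_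
  rw [(Finset.mem_filter.1 hy).2]

open Classical in
/-- The image of a distribution on states under the quotient map to equivalence classes. -/
noncomputable def classMass (π : State N → ℝ) (b : RState N) : ℝ :=
  ∑ x with Quotient.mk (dihedralSetoid N) x = b, π x

lemma sum_classMass_mul (π : State N → ℝ) (g : RState N → ℝ) :
    ∑ b, classMass π b * g b = ∑ x, π x * g (Quotient.mk _ x) :=
  sum_classSum_mul (fun _ => π) 0 g

lemma IsStationary.classMass {Q : Matrix (State N) (State N) ℝ} (hQ : IsLumpable Q)
    {π : State N → ℝ} (hπ : IsStationary Q π) : IsStationary (reduced Q) (classMass π) := by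
  refine ⟨⟨fun b => Finset.sum_nonneg fun x _ => hπ.1.1 x, ?_⟩, ?_⟩
  · simpa [hπ.1.2] using sum_classMass_mul π 1
  · funext b
    refine (sum_classMass_mul π fun a => reduced Q a b).trans ?_
    simp only [hQ.reduced_mk, classSum, Finset.mul_sum]
    rw [Finset.sum_comm]
    exact Finset.sum_congr rfl fun y _ => congrFun hπ.2 y

lemma classMass_dotProduct_reduced {Q : Matrix (State N) (State N) ℝ} (hQ : IsLumpable Q)
    (π : State N → ℝ) : classMass π ⬝ᵥ (reduced Q *ᵥ 1) = π ⬝ᵥ (Q *ᵥ 1) := by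
  refine (sum_classMass_mul π (reduced Q *ᵥ 1)).trans (Finset.sum_congr rfl fun x _ => ?_)
  congr 1
  simp only [mulVec, dotProduct, hQ.reduced_mk]
  exact sum_classSum_mul Q x 1

open Classical in
lemma reduced_mem_rowStochastic {Q : Matrix (State N) (State N) ℝ}
    (hQ : Q ∈ rowStochastic ℝ (State N)) : reduced Q ∈ rowStochastic ℝ (RState N) := by
  rw [mem_rowStochastic_iff_sum]
  refine ⟨fun a b => Finset.sum_nonneg fun y _ => nonneg_of_mem_rowStochastic hQ, fun a => ?_⟩
  have h := sum_classSum_mul Q a.out 1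
  simp only [Pi.one_apply, mul_one, sum_row_of_mem_rowStochastic hQ] at h
  exact h

lemma reduced_reachable {Q : Matrix (State N) (State N) ℝ} (hQ : Q ∈ rowStochastic ℝ (State N))
    (hL : IsLumpable Q) {z : State N}
    (hz : ∀ x, Relation.ReflTransGen (fun a b => 0 < Q a b) x z) (a : RState N) :
    Relation.ReflTransGen (fun a b => 0 < reduced Q a b) a (Quotient.mk _ z) := by
  induction a using Quotient.inductionOn with | _ x
  refine (hz x).lift (Quotient.mk (dihedralSetoid N)) fun x y hxy => ?_
  have h : 0 < classSum Q x (Quotient.mk _ y) :=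
    Finset.sum_pos' (fun y _ => nonneg_of_mem_rowStochastic hQ) ⟨y, by simp, hxy⟩
  rwa [← hL.reduced_mk] at h

end Lumping

/-! ### A strong law of large numbers for bounded increments with vanishing mixed moments -/

section StrongLaw

variable {Ω : Type*} [MeasurableSpace Ω] {P : Measure Ω}

/-- The fourth moments of `Sₙ / n` are summable, so that `∑ n, (Sₙ / n) ^ 4` has a finite
expectation and its terms tend to `0` almost surely. -/
lemma ae_tendsto_div_of_integral_pow_four_le {S : ℕ → Ω → ℝ} (hS : ∀ n, Measurable (S n))
    (hint : ∀ n, Integrable (fun ω => S n ω ^ 4) P) {K : ℝ}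
    (hK : ∀ n, ∫ ω, S n ω ^ 4 ∂P ≤ K * (n : ℝ) ^ 2) :
    ∀ᵐ ω ∂P, Tendsto (fun n : ℕ => S n ω / n) atTop (𝓝 0) := by
  have hK0 : 0 ≤ K := by
    have := (integral_nonneg fun ω => by positivity).trans (hK 1)
    simpa using this
  have hle : ∀ n : ℕ, ∫⁻ ω, ENNReal.ofReal ((S n ω / n) ^ 4) ∂P ≤
      ENNReal.ofReal (K * (1 / (n : ℝ) ^ 2)) := fun n => by
    have hdiv : ∀ ω, (S n ω / n) ^ 4 = S n ω ^ 4 / (n : ℝ) ^ 4 := fun ω => div_pow _ _ _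
    rw [← ofReal_integral_eq_lintegral_ofReal (by simpa only [hdiv] using (hint n).div_const _)
      (ae_of_all _ fun ω => by positivity)]
    refine ENNReal.ofReal_le_ofReal ?_
    simp only [hdiv]
    rw [integral_div]
    rcases Nat.eq_zero_or_pos n with rfl | hn
    · simp
    · have hn' : (0 : ℝ) < n := Nat.cast_pos.2 hn
      rw [div_le_iff₀ (by positivity)]
      refine (hK n).trans (le_of_eq ?_)
      field_simp
  have hsum : ∫⁻ ω, ∑' n : ℕ, ENNReal.ofReal ((S n ω / n) ^ 4) ∂P ≠ ⊤ := by
    rw [lintegral_tsum fun n => by fun_prop]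
    refine ne_top_of_le_ne_top ?_ (ENNReal.tsum_le_tsum hle)
    have := (Real.summable_one_div_nat_pow.2 one_lt_two).mul_left K
    exact this.tsum_ofReal_ne_top
  filter_upwards [ae_lt_top (by fun_prop) hsum] with ω hω
  have h4 := ENNReal.tendsto_atTop_zero_of_tsum_ne_top hω.ne
  have h4' : Tendsto (fun n : ℕ => (S n ω / n) ^ 4) atTop (𝓝 0) := by
    have := (ENNReal.tendsto_toReal ENNReal.zero_ne_top).comp h4
    refine this.congr fun n => ?_
    exact ENNReal.toReal_ofReal (by positivity)
  rw [tendsto_zero_iff_abs_tendsto_zero]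
  have hroot := ((Real.continuous_sqrt.comp Real.continuous_sqrt).tendsto 0).comp h4'
  simp only [Function.comp_def, Real.sqrt_zero] at hroot
  refine hroot.congr fun n => ?_
  rw [show (S n ω / n) ^ 4 = ((S n ω / n) ^ 2) ^ 2 by ring, Real.sqrt_sq (by positivity),
    Real.sqrt_sq_eq_abs]
  rfl

/-- The hypotheses on `∫ S D` and `∫ S ^ 3 D` hold for bounded martingale differences; they give
`∫ Sₙ ^ 2 ≤ C ^ 2 n` and then `∫ Sₙ ^ 4 ≤ 4 C ^ 4 n ^ 2`. -/
theorem ae_tendsto_sum_div_of_integral_mul_eq_zero [IsProbabilityMeasure P]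
    {D : ℕ → Ω → ℝ} (hD : ∀ n, Measurable (D n)) {C : ℝ} (hC : ∀ᵐ ω ∂P, ∀ n, |D n ω| ≤ C)
    (h1 : ∀ n, ∫ ω, (∑ k ∈ Finset.range n, D k ω) * D n ω ∂P = 0)
    (h3 : ∀ n, ∫ ω, (∑ k ∈ Finset.range n, D k ω) ^ 3 * D n ω ∂P = 0) :
    ∀ᵐ ω ∂P, Tendsto (fun n : ℕ => (∑ k ∈ Finset.range n, D k ω) / n) atTop (𝓝 0) := by
  set S : ℕ → Ω → ℝ := fun n ω => ∑ k ∈ Finset.range n, D k ω with hSdef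
  have hS : ∀ n, Measurable (S n) := fun n => by fun_prop
  have hSb : ∀ᵐ ω ∂P, ∀ n, |S n ω| ≤ n * C := by
    filter_upwards [hC] with ω hω n
    calc |S n ω| ≤ ∑ k ∈ Finset.range n, |D k ω| := Finset.abs_sum_le_sum_abs _ _
      _ ≤ ∑ k ∈ Finset.range n, C := Finset.sum_le_sum fun k _ => hω k
      _ = n * C := by simp
  have hint : ∀ n a b, Integrable (fun ω => S n ω ^ a * D n ω ^ b) P := fun n a b => by
    refine Integrable.of_bound (by fun_prop) ((n * C) ^ a * C ^ b) ?_
    filter_upwards [hSb, hC] with ω h h'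
    rw [norm_mul, norm_pow, norm_pow, Real.norm_eq_abs, Real.norm_eq_abs]
    have := h n
    have := h' n
    have : 0 ≤ C := (abs_nonneg _).trans (h' n)
    gcongr
  have hintS : ∀ n a, Integrable (fun ω => S n ω ^ a) P := fun n a => by
    simpa using hint n a 0
  have hsucc : ∀ n ω, S (n + 1) ω = S n ω + D n ω := fun n ω => Finset.sum_range_succ _ _
  have hsq : ∀ n : ℕ, ∫ ω, S n ω ^ 2 ∂P ≤ C ^ 2 * n := by
    intro n
    induction n with
    | zero => simp [hSdef]
    | succ n ih =>
      have i1 : Integrable (fun ω => 2 * (S n ω * D n ω)) P := by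
        simpa using (hint n 1 1).const_mul 2
      have i2 : Integrable (fun ω => S n ω ^ 2 + 2 * (S n ω * D n ω)) P := (hintS n 2).add i1
      calc ∫ ω, S (n + 1) ω ^ 2 ∂P
          ≤ ∫ ω, (S n ω ^ 2 + 2 * (S n ω * D n ω) + C ^ 2) ∂P := by
            refine integral_mono_ae (hintS _ _)
              (i2.add (integrable_const _)) ?_
            filter_upwards [hC] with ω hω
            have := sq_le_sq' (abs_le.1 (hω n)).1 (abs_le.1 (hω n)).2
            simp only [hsucc]
            linarith [add_sq (S n ω) (D n ω)]
        _ = ∫ ω, S n ω ^ 2 ∂P + C ^ 2 := by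
            rw [integral_add i2 (integrable_const _),
              integral_add (hintS n 2) i1, integral_const_mul, h1 n]
            simp
        _ ≤ C ^ 2 * (n + 1 : ℕ) := by
            push_cast
            linarith
  refine ae_tendsto_div_of_integral_pow_four_le hS (fun n => hintS n 4) (K := 4 * C ^ 4) ?_
  intro n
  induction n with
  | zero => simp
  | succ n ih =>
    have i1 : Integrable (fun ω => 4 * (S n ω ^ 3 * D n ω)) P := by
      simpa using (hint n 3 1).const_mul 4
    have i2 : Integrable (fun ω => 8 * C ^ 2 * S n ω ^ 2) P := (hintS n 2).const_mul _
    have i3 : Integrable (fun ω => S n ω ^ 4 + 4 * (S n ω ^ 3 * D n ω)) P := (hintS n 4).add i1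
    have i4 : Integrable
        (fun ω => S n ω ^ 4 + 4 * (S n ω ^ 3 * D n ω) + 8 * C ^ 2 * S n ω ^ 2) P := i3.add i2
    calc ∫ ω, S (n + 1) ω ^ 4 ∂P
        ≤ ∫ ω, (S n ω ^ 4 + 4 * (S n ω ^ 3 * D n ω) + 8 * C ^ 2 * S n ω ^ 2 + 3 * C ^ 4) ∂P := by
          refine integral_mono_ae (hintS _ _)
            (i4.add (integrable_const _)) ?_
          filter_upwards [hC] with ω hω
          have hsq : D n ω ^ 2 ≤ C ^ 2 := sq_le_sq' (abs_le.1 (hω n)).1 (abs_le.1 (hω n)).2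
          have h4 : D n ω ^ 4 ≤ C ^ 4 := by
            have := pow_le_pow_left₀ (sq_nonneg _) hsq 2
            nlinarith
          have hSD : S n ω ^ 2 * D n ω ^ 2 ≤ S n ω ^ 2 * C ^ 2 := by gcongr
          -- `4 S D³ ≤ 2 S² D² + 2 D⁴`
          have hmix : 0 ≤ (D n ω * (S n ω - D n ω)) ^ 2 := sq_nonneg _
          simp only [hsucc]
          nlinarith
      _ = ∫ ω, S n ω ^ 4 ∂P + 8 * C ^ 2 * ∫ ω, S n ω ^ 2 ∂P + 3 * C ^ 4 := by
          rw [integral_add i4 (integrable_const _),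
            integral_add i3 i2, integral_add (hintS n 4) i1,
            integral_const_mul, integral_const_mul, h3 n]
          simp
      _ ≤ 4 * C ^ 4 * ((n + 1 : ℕ) : ℝ) ^ 2 := by
          have := mul_le_mul_of_nonneg_left (hsq n) (by positivity : 0 ≤ 8 * C ^ 2)
          have hC4 : 0 ≤ C ^ 4 := by positivity
          push_cast
          nlinarith

end StrongLaw

/-! ### The law of one turn -/

section TurnLaw

variable {N : ℕ} [NeZero N] {p : Fin 3 → ℝ} {γ : ℝ}

lemma turnProb_nonneg (hp : ∀ m, p m ∈ Set.Icc (0 : ℝ) 1) (hγ : γ ∈ Set.Ioo (0 : ℝ) 1)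
    (x y : State N) (w : ℤ) : 0 ≤ turnProb p γ x y w := by
  have h0 := fun m => (hp m).1
  have h1 := fun m => sub_nonneg.2 (hp m).2
  have hγ0 := hγ.1.le
  have hγ1 := sub_nonneg.2 hγ.2.le
  refine add_nonneg (by positivity) (mul_nonneg hγ1 (Finset.sum_nonneg fun i _ => ?_))
  exact mul_nonneg (by positivity)
    (add_nonneg (mul_nonneg (h0 _) (by positivity)) (mul_nonneg (h1 _) (by positivity)))

lemma turnProb_eq_zero (x y : State N) {w : ℤ} (hw : w ∉ Finset.Icc (-1 : ℤ) 1) :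
    turnProb p γ x y w = 0 := by
  have h1 : w ≠ -1 + 1 := by rintro rfl; simp at hw
  have h2 : w ≠ 1 := by rintro rfl; simp at hw
  have h3 : w ≠ -1 := by rintro rfl; simp at hw
  simp only [turnProb, h1, h2, h3, and_false, if_false]
  simp

/-- The profit of a turn is `0` in game `A'`, and in game `B` it is `1` or `-1` according to the
coin; the formula averages a function `g` of the profit. -/
lemma sum_mul_turnProb (g : ℤ → ℝ) (x y : State N) :
    ∑ w ∈ Finset.Icc (-1 : ℤ) 1, g w * turnProb p γ x y w =
      γ * g 0 * matA N x y +
        (1 - γ) * matBpq N (fun m => g 1 * p m) (fun m => g (-1) * (1 - p m)) x y := by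
  have hIcc : Finset.Icc (-1 : ℤ) 1 = {-1, 0, 1} := rfl
  rw [hIcc, Finset.sum_insert (by decide), Finset.sum_insert (by decide), Finset.sum_singleton,
    matBpq_apply, matA]
  simp only [turnProb, eq_comm (a := y)]
  norm_num
  simp only [Finset.mul_sum, ← Finset.sum_add_distrib, mul_ite, mul_zero]
  refine Finset.sum_congr rfl fun i _ => ?_
  split_ifs <;> ring

lemma sum_turnProb (x y : State N) :
    ∑ w ∈ Finset.Icc (-1 : ℤ) 1, turnProb p γ x y w = matC N p γ x y := by
  simpa [matC, matB] using sum_mul_turnProb (p := p) (γ := γ) (fun _ => 1) x y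

lemma sum_cast_mul_turnProb (x y : State N) :
    ∑ w ∈ Finset.Icc (-1 : ℤ) 1, (w : ℝ) * turnProb p γ x y w = dotC N p γ x y := by
  simpa [dotC, dotA, dotB] using sum_mul_turnProb (p := p) (γ := γ) (fun w => (w : ℝ)) x y

/-- The joint distribution of the next state and the profit of one turn from state `x`. Profits
of a turn are at most `1` in absolute value, so that it is a finite sum of point masses. -/
noncomputable def turnLaw (p : Fin 3 → ℝ) (γ : ℝ) (x : State N) : Measure (State N × ℤ) :=
  ∑ a ∈ Finset.univ ×ˢ Finset.Icc (-1 : ℤ) 1,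
    ENNReal.ofReal (turnProb p γ x a.1 a.2) • Measure.dirac a

lemma isProbabilityMeasure_turnLaw (hp : ∀ m, p m ∈ Set.Icc (0 : ℝ) 1)
    (hγ : γ ∈ Set.Ioo (0 : ℝ) 1) (x : State N) : IsProbabilityMeasure (turnLaw p γ x) := by
  constructor
  simp only [turnLaw, Measure.finsetSum_apply, Measure.smul_apply, measure_univ, smul_eq_mul,
    mul_one]
  rw [← ENNReal.ofReal_sum_of_nonneg fun a _ => turnProb_nonneg hp hγ _ _ _,
    Finset.sum_product]
  simp [sum_turnProb, sum_row_of_mem_rowStochastic (matC_mem_rowStochastic hp hγ)]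

lemma turnLaw_singleton (x : State N) (a : State N × ℤ) :
    turnLaw p γ x {a} = ENNReal.ofReal (turnProb p γ x a.1 a.2) := by
  classical
  simp only [turnLaw, Measure.finsetSum_apply, Measure.smul_apply, smul_eq_mul,
    Measure.dirac_apply, Set.indicator_apply, Set.mem_singleton_iff, Pi.one_apply, mul_ite,
    mul_one, mul_zero, Finset.sum_ite_eq']
  by_cases ha : a.2 ∈ Finset.Icc (-1 : ℤ) 1
  · rw [if_pos (by simpa using ha)]
  · rw [if_neg (by simpa using ha), turnProb_eq_zero x a.1 ha, ENNReal.ofReal_zero]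

lemma integral_turnLaw (hp : ∀ m, p m ∈ Set.Icc (0 : ℝ) 1) (hγ : γ ∈ Set.Ioo (0 : ℝ) 1)
    (x : State N) (f : State N × ℤ → ℝ) :
    ∫ a, f a ∂(turnLaw p γ x) =
      ∑ y, ∑ w ∈ Finset.Icc (-1 : ℤ) 1, turnProb p γ x y w * f (y, w) := by
  rw [turnLaw, integral_finsetSum_measure fun a _ =>
    ((integrable_dirac (by simp)).smul_measure ENNReal.ofReal_ne_top), Finset.sum_product]
  simp [integral_smul_measure, ENNReal.toReal_ofReal (turnProb_nonneg hp hγ _ _ _)]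

lemma ae_turnLaw (x : State N) : ∀ᵐ a ∂(turnLaw p γ x), |(a.2 : ℝ)| ≤ 1 := by
  rw [turnLaw, ae_iff, Measure.finsetSum_apply]
  refine Finset.sum_eq_zero fun a ha => ?_
  have h : |(a.2 : ℝ)| ≤ 1 := by
    have := Finset.mem_Icc.1 (Finset.mem_product.1 ha).2
    exact abs_le.2 ⟨by exact_mod_cast this.1, by exact_mod_cast this.2⟩
  simp only [Measure.smul_apply, Measure.dirac_apply, smul_eq_mul]
  rw [Set.indicator_of_notMem (by simpa using h), mul_zero]

end TurnLaw

/-! ### Plays of the game -/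

section Play

variable {N : ℕ} [NeZero N] {p : Fin 3 → ℝ} {γ : ℝ} {Ω : Type*} [MeasurableSpace Ω]
  {P : Measure Ω} {X : ℕ → Ω → State N} {W : ℕ → Ω → ℤ}

/-- Histories of the first `n` turns: the states `X 0, …, X n` and the profits
`W 0, …, W (n - 1)`. -/
abbrev Hist (N n : ℕ) : Type := (Fin (n + 1) → State N) × (Fin n → ℤ)

/-- The history of the first `n` turns of a play. -/
def hist (X : ℕ → Ω → State N) (W : ℕ → Ω → ℤ) (n : ℕ) (ω : Ω) : Hist N n :=
  (fun k => X k ω, fun k => W k ω)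

lemma IsPlay.measurable_hist (h : IsPlay p γ P X W) (n : ℕ) : Measurable (hist X W n) :=
  Measurable.prodMk (measurable_pi_lambda _ fun k => h.measurable_state k)
    (measurable_pi_lambda _ fun k => h.measurable_profit k)

lemma IsPlay.measurable_next (h : IsPlay p γ P X W) (n : ℕ) :
    Measurable fun ω => (X (n + 1) ω, W n ω) :=
  (h.measurable_state (n + 1)).prodMk (h.measurable_profit n)

/-- The distribution of a turn given the history. -/
noncomputable def turnKernel (p : Fin 3 → ℝ) (γ : ℝ) (n : ℕ) :
    ProbabilityTheory.Kernel (Hist N n) (State N × ℤ) :=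
  .ofFunOfCountable fun a => turnLaw p γ (a.1 (Fin.last n))

lemma turnKernel_apply (n : ℕ) (a : Hist N n) :
    turnKernel p γ n a = turnLaw p γ (a.1 (Fin.last n)) := rfl

lemma isMarkovKernel_turnKernel (hp : ∀ m, p m ∈ Set.Icc (0 : ℝ) 1)
    (hγ : γ ∈ Set.Ioo (0 : ℝ) 1) (n : ℕ) :
    ProbabilityTheory.IsMarkovKernel (turnKernel (N := N) p γ n) :=
  ⟨fun _ => isProbabilityMeasure_turnLaw hp hγ _⟩

/-- The defining property of a play, as a disintegration of the joint law of the history and the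
turn that follows it. Histories are countable, so it suffices to compare the masses of points. -/
lemma IsPlay.map_hist_next [IsProbabilityMeasure P] (hp : ∀ m, p m ∈ Set.Icc (0 : ℝ) 1)
    (hγ : γ ∈ Set.Ioo (0 : ℝ) 1) (h : IsPlay p γ P X W) (n : ℕ) :
    P.map (fun ω => (hist X W n ω, (X (n + 1) ω, W n ω))) =
      (P.map (hist X W n)) ⊗ₘ turnKernel p γ n := by
  have := isMarkovKernel_turnKernel (N := N) hp hγ n
  have hH := h.measurable_hist n
  have hY := h.measurable_next n
  have := Measure.isProbabilityMeasure_map (μ := P) hH.aemeasurable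
  rw [Measure.ext_iff_singleton]
  rintro ⟨⟨x, w⟩, ⟨y, v⟩⟩
  rw [Measure.map_apply (hH.prodMk hY) (measurableSet_singleton _),
    ← Set.singleton_prod_singleton,
    Measure.compProd_apply_prod (measurableSet_singleton _) (measurableSet_singleton _),
    lintegral_singleton, turnKernel_apply, turnLaw_singleton,
    Measure.map_apply hH (measurableSet_singleton _)]
  have hturn := h.turn n (fun k => if hk : k < n + 1 then x ⟨k, hk⟩ else y)
    (fun k => if hk : k < n then w ⟨k, hk⟩ else v)
  have hpast : {ω | (∀ k ≤ n, X k ω = if hk : k < n + 1 then x ⟨k, hk⟩ else y) ∧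
      ∀ k < n, W k ω = if hk : k < n then w ⟨k, hk⟩ else v} = hist X W n ⁻¹' {(x, w)} := by
    ext ω
    simp only [Set.mem_ofPred_eq, Set.mem_preimage, Set.mem_singleton_iff, hist, Prod.mk.injEq,
      funext_iff, Fin.forall_iff]
    refine and_congr (forall_congr' fun k => ?_) (forall_congr' fun k => ?_)
    · exact ⟨fun H hk => by simpa [hk] using H (by omega),
        fun H hk => by simpa [Nat.lt_succ_of_le hk] using H (by omega)⟩
    · exact forall_congr' fun hk => by simp [hk]
  have hnext : {ω | (∀ k ≤ n + 1, X k ω = if hk : k < n + 1 then x ⟨k, hk⟩ else y) ∧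
      ∀ k < n + 1, W k ω = if hk : k < n then w ⟨k, hk⟩ else v} =
      (fun ω => (hist X W n ω, (X (n + 1) ω, W n ω))) ⁻¹' ({(x, w)} ×ˢ {(y, v)}) := by
    rw [Set.mk_preimage_prod, ← hpast]
    ext ω
    simp only [Set.mem_ofPred_eq, Set.mem_inter_iff, Set.mem_preimage, Set.mem_singleton_iff,
      Prod.mk.injEq, Nat.le_succ_iff, Nat.lt_succ_iff_lt_or_eq]
    constructor
    · rintro ⟨hx, hw⟩
      exact ⟨⟨fun k hk => hx k (Or.inl hk), fun k hk => hw k (Or.inl hk)⟩,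
        by simpa using hx (n + 1) (Or.inr rfl), by simpa using hw n (Or.inr rfl)⟩
    · rintro ⟨⟨hx, hw⟩, hy, hv⟩
      constructor
      · rintro k (hk | rfl)
        · exact hx k hk
        · simpa using hy
      · rintro k (hk | rfl)
        · exact hw k hk
        · simpa using hv
  rw [hpast, hnext] at hturn
  simp only [Nat.lt_irrefl, dite_false, Nat.lt_succ_self, dite_true] at hturn
  rw [← ofReal_measureReal, ← ofReal_measureReal (μ := P) (s := hist X W n ⁻¹' _), hturn,
    ENNReal.ofReal_mul measureReal_nonneg, mul_comm]
  rfl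

lemma IsPlay.integral_next [IsProbabilityMeasure P] (hp : ∀ m, p m ∈ Set.Icc (0 : ℝ) 1)
    (hγ : γ ∈ Set.Ioo (0 : ℝ) 1) (h : IsPlay p γ P X W) (n : ℕ)
    (F : Hist N n → State N × ℤ → ℝ)
    (hF : Integrable (fun ω => F (hist X W n ω) (X (n + 1) ω, W n ω)) P) :
    ∫ ω, F (hist X W n ω) (X (n + 1) ω, W n ω) ∂P =
      ∫ ω, ∑ y, ∑ w ∈ Finset.Icc (-1 : ℤ) 1,
        turnProb p γ (X n ω) y w * F (hist X W n ω) (y, w) ∂P := by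
  have := isMarkovKernel_turnKernel (N := N) hp hγ n
  have hH := h.measurable_hist n
  have hHY := hH.prodMk (h.measurable_next n)
  have := Measure.isProbabilityMeasure_map (μ := P) hH.aemeasurable
  have hmeas : Measurable (Function.uncurry F) := measurable_of_countable _
  have hint : Integrable (Function.uncurry F) (P.map (hist X W n) ⊗ₘ turnKernel p γ n) := by
    rw [← h.map_hist_next hp hγ n, integrable_map_measure hmeas.aestronglyMeasurable
      hHY.aemeasurable]
    exact hF
  calc ∫ ω, F (hist X W n ω) (X (n + 1) ω, W n ω) ∂P
      = ∫ a, Function.uncurry F a ∂(P.map fun ω => (hist X W n ω, (X (n + 1) ω, W n ω))) :=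
        (integral_map hHY.aemeasurable hmeas.aestronglyMeasurable).symm
    _ = ∫ a, ∫ b, F a b ∂(turnLaw p γ (a.1 (Fin.last n))) ∂(P.map (hist X W n)) := by
        rw [h.map_hist_next hp hγ n, Measure.integral_compProd hint]
        rfl
    _ = _ := by
        rw [integral_map hH.aemeasurable (measurable_of_countable _).aestronglyMeasurable]
        simp only [integral_turnLaw hp hγ]
        rfl

lemma IsPlay.ae_abs_profit_le [IsProbabilityMeasure P] (hp : ∀ m, p m ∈ Set.Icc (0 : ℝ) 1)
    (hγ : γ ∈ Set.Ioo (0 : ℝ) 1) (h : IsPlay p γ P X W) :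
    ∀ᵐ ω ∂P, ∀ n, |(W n ω : ℝ)| ≤ 1 := by
  refine ae_all_iff.2 fun n => ?_
  have hset : MeasurableSet {a : Hist N n × (State N × ℤ) | |(a.2.2 : ℝ)| ≤ 1} :=
    (Set.to_countable _).measurableSet
  have key : ∀ᵐ a ∂(P.map fun ω => (hist X W n ω, (X (n + 1) ω, W n ω))),
      |(a.2.2 : ℝ)| ≤ 1 := by
    rw [h.map_hist_next hp hγ n]
    exact Measure.ae_compProd_of_ae_ae hset (ae_of_all _ fun a => ae_turnLaw _)
  exact ae_of_ae_map ((h.measurable_hist n).prodMk (h.measurable_next n)).aemeasurable key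

lemma IsPlay.integrable_profit [IsProbabilityMeasure P] (hp : ∀ m, p m ∈ Set.Icc (0 : ℝ) 1)
    (hγ : γ ∈ Set.Ioo (0 : ℝ) 1) (h : IsPlay p γ P X W) (n : ℕ) :
    Integrable (fun ω => (W n ω : ℝ)) P := by
  have := h.measurable_profit n
  refine Integrable.of_bound (by fun_prop) 1 ?_
  filter_upwards [h.ae_abs_profit_le hp hγ] with ω hω using hω n

/-- An average over a turn of a function of the next state plus the profit. -/
lemma sum_turnProb_mul (hp : ∀ m, p m ∈ Set.Icc (0 : ℝ) 1) (hγ : γ ∈ Set.Ioo (0 : ℝ) 1)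
    (x : State N) (g : State N → ℝ) (a b : ℝ) :
    ∑ y, ∑ w ∈ Finset.Icc (-1 : ℤ) 1, turnProb p γ x y w * (a * (w + g y + b)) =
      a * ((dotC N p γ *ᵥ 1) x + (matC N p γ *ᵥ g) x + b) := by
  have h1 := sum_row_of_mem_rowStochastic (matC_mem_rowStochastic (N := N) hp hγ) x
  have hy : ∀ y, ∑ w ∈ Finset.Icc (-1 : ℤ) 1, turnProb p γ x y w * (a * (w + g y + b)) =
      a * (dotC N p γ x y + matC N p γ x y * g y + matC N p γ x y * b) := fun y => by
    rw [← sum_turnProb, ← sum_cast_mul_turnProb, Finset.sum_mul, Finset.sum_mul,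
      ← Finset.sum_add_distrib, ← Finset.sum_add_distrib, Finset.mul_sum]
    exact Finset.sum_congr rfl fun w _ => by ring
  simp only [hy, ← Finset.mul_sum, Finset.sum_add_distrib, ← Finset.sum_mul, h1, one_mul]
  simp [mulVec, dotProduct]

/-- The law of the current state averages functions of it. -/
lemma IsPlay.integral_state [IsProbabilityMeasure P] (h : IsPlay p γ P X W) (n : ℕ)
    (g : State N → ℝ) : ∫ ω, g (X n ω) ∂P = ∑ x, P.real {ω | X n ω = x} * g x := by
  have hX := h.measurable_state n
  have := Measure.isProbabilityMeasure_map (μ := P) hX.aemeasurable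
  rw [← integral_map hX.aemeasurable (measurable_of_countable g).aestronglyMeasurable,
    integral_fintype .of_finite]
  refine Finset.sum_congr rfl fun x _ => ?_
  rw [map_measureReal_apply hX (measurableSet_singleton x), smul_eq_mul]
  rfl

lemma IsPlay.integrable_comp_state [IsProbabilityMeasure P] (h : IsPlay p γ P X W) (n : ℕ)
    (g : State N → ℝ) : Integrable (fun ω => g (X n ω)) P := by
  have hX := h.measurable_state n
  have := Measure.isProbabilityMeasure_map (μ := P) hX.aemeasurable
  exact (Integrable.of_finite (μ := P.map (X n)) (f := g)).comp_measurable hX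

lemma IsPlay.integral_profit [IsProbabilityMeasure P] (hp : ∀ m, p m ∈ Set.Icc (0 : ℝ) 1)
    (hγ : γ ∈ Set.Ioo (0 : ℝ) 1) (h : IsPlay p γ P X W) (n : ℕ) :
    ∫ ω, (W n ω : ℝ) ∂P = (fun x => P.real {ω | X n ω = x}) ⬝ᵥ (dotC N p γ *ᵥ 1) := by
  have hs := fun x : State N => sum_turnProb_mul hp hγ x 0 1 0
  simp only [Pi.zero_apply, add_zero, one_mul, mulVec_zero] at hs
  rw [h.integral_next hp hγ n (fun _ b => (b.2 : ℝ)) (h.integrable_profit hp hγ n)]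
  simp only [hs]
  exact h.integral_state n _

/-- A play whose state has the same distribution at all times starts from a stationary
distribution. -/
lemma IsPlay.isStationary [IsProbabilityMeasure P] (hp : ∀ m, p m ∈ Set.Icc (0 : ℝ) 1)
    (hγ : γ ∈ Set.Ioo (0 : ℝ) 1) (h : IsPlay p γ P X W)
    (hX : ∀ n x, P.real {ω | X n ω = x} = P.real {ω | X 0 ω = x}) :
    IsStationary (matC N p γ) fun x => P.real {ω | X 0 ω = x} := by
  refine ⟨⟨fun x => measureReal_nonneg, ?_⟩, ?_⟩
  · simpa using (h.integral_state 0 1).symm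
  · funext y
    -- average the indicator function of the state `y` after one turn
    have hn := h.integral_next hp hγ 0 (fun _ b => Pi.single (M := fun _ => ℝ) y 1 b.1)
      (h.integrable_comp_state 1 (Pi.single y 1))
    simp only [← Finset.sum_mul, sum_turnProb] at hn
    rw [h.integral_state (0 + 1), h.integral_state 0
      fun x => ∑ z, matC N p γ x z * Pi.single (M := fun _ => ℝ) y 1 z] at hn
    simpa [Pi.single_apply, hX 1, vecMul, dotProduct] using hn.symm

/-- The strong law for the profit: with a solution `g` of the Poisson equation, the increments
`W n - μ + g (X (n + 1)) - g (X n)` have mean zero given the history, and their sums differ from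
those of `W n - μ` by the bounded term `g (X n) - g (X 0)`. -/
theorem IsPlay.ae_tendsto [IsProbabilityMeasure P] (hp : ∀ m, p m ∈ Set.Icc (0 : ℝ) 1)
    (hγ : γ ∈ Set.Ioo (0 : ℝ) 1) (h : IsPlay p γ P X W) {μ : ℝ} {g : State N → ℝ}
    (hg : g - matC N p γ *ᵥ g = dotC N p γ *ᵥ 1 - μ • 1) :
    ∀ᵐ ω ∂P, Tendsto (fun n : ℕ => (∑ k ∈ Finset.range n, (W k ω : ℝ)) / n) atTop (𝓝 μ) := by
  have hWm : ∀ n, Measurable fun ω => (W n ω : ℝ) := fun n =>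
    (measurable_of_countable _).comp (h.measurable_profit n)
  have hgm : ∀ n, Measurable fun ω => g (X n ω) := fun n =>
    (measurable_of_countable g).comp (h.measurable_state n)
  set D : ℕ → Ω → ℝ := fun n ω => W n ω + g (X (n + 1) ω) + (-μ - g (X n ω)) with hD
  have hDm : ∀ n, Measurable (D n) := fun n => by
    exact ((hWm n).add (hgm (n + 1))).add ((hgm n).const_sub (-μ))
  obtain ⟨B, hB⟩ : ∃ B, ∀ x, |g x| ≤ B := by
    obtain ⟨B, hB⟩ := (Set.finite_range fun x => |g x|).bddAbove
    exact ⟨B, fun x => hB ⟨x, rfl⟩⟩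
  have hC : ∀ᵐ ω ∂P, ∀ n, |D n ω| ≤ 1 + |μ| + 2 * B := by
    filter_upwards [h.ae_abs_profit_le hp hγ] with ω hω n
    have h1 := abs_le.1 (hω n)
    have h2 := abs_le.1 (hB (X (n + 1) ω))
    have h3 := abs_le.1 (hB (X n ω))
    have h4 := neg_abs_le μ
    have h5 := le_abs_self μ
    rw [abs_le]
    constructor <;> linarith
  have hsum : ∀ n ω, ∑ k ∈ Finset.range n, D k ω =
      ∑ k ∈ Finset.range n, (W k ω : ℝ) - n * μ + (g (X n ω) - g (X 0 ω)) := fun n ω => by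
    rw [← Finset.sum_range_sub fun k => g (X k ω)]
    simp only [hD, Finset.sum_add_distrib, Finset.sum_sub_distrib, Finset.sum_const,
      Finset.card_range, nsmul_eq_mul]
    ring
  -- the sum of the first `n` increments as a function of the history of `n` turns
  set T : ∀ n, Hist N n → ℝ := fun n a =>
    ∑ k, (a.2 k : ℝ) - n * μ + (g (a.1 (Fin.last n)) - g (a.1 0)) with hT
  have hTD : ∀ n ω, T n (hist X W n ω) = ∑ k ∈ Finset.range n, D k ω := fun n ω => by
    rw [hsum, Finset.sum_range]
    rfl
  have horth : ∀ n j, ∫ ω, (∑ k ∈ Finset.range n, D k ω) ^ j * D n ω ∂P = 0 := by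
    intro n j
    have hint : Integrable (fun ω => (∑ k ∈ Finset.range n, D k ω) ^ j * D n ω) P := by
      refine Integrable.of_bound (by fun_prop)
        ((∑ k ∈ Finset.range n, (1 + |μ| + 2 * B)) ^ j * (1 + |μ| + 2 * B)) ?_
      filter_upwards [hC] with ω hω
      rw [norm_mul, norm_pow, Real.norm_eq_abs, Real.norm_eq_abs]
      have h1 : |∑ k ∈ Finset.range n, D k ω| ≤ ∑ k ∈ Finset.range n, (1 + |μ| + 2 * B) :=
        (Finset.abs_sum_le_sum_abs _ _).trans (Finset.sum_le_sum fun k _ => hω k)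
      have h0 : 0 ≤ ∑ k ∈ Finset.range n, (1 + |μ| + 2 * B) := (abs_nonneg _).trans h1
      have h2 := hω n
      gcongr
    simp only [← hTD] at hint ⊢
    refine (h.integral_next hp hγ n (fun a b => T n a ^ j *
      (b.2 + g b.1 + (-μ - g (a.1 (Fin.last n))))) hint).trans ?_
    simp only [sum_turnProb_mul hp hγ]
    refine integral_eq_zero_of_ae (ae_of_all _ fun ω => ?_)
    have := congrFun hg (X n ω)
    simp only [Pi.sub_apply, Pi.smul_apply, Pi.one_apply, smul_eq_mul, mul_one] at this
    change _ * (_ + _ + (-μ - g (X n ω))) = 0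
    rw [mul_eq_zero]
    right
    linarith
  have hlim := ae_tendsto_sum_div_of_integral_mul_eq_zero hDm hC
    (fun n => by simpa using horth n 1) (fun n => horth n 3)
  filter_upwards [hlim] with ω hω
  have hbdd : Tendsto (fun n : ℕ => (g (X n ω) - g (X 0 ω)) / n) atTop (𝓝 0) := by
    refine squeeze_zero_norm (a := fun n : ℕ => 2 * B / n) (fun n => ?_)
      (tendsto_const_div_atTop_nhds_zero_nat _)
    rw [norm_div, Real.norm_natCast, Real.norm_eq_abs]
    gcongr
    have h2 := abs_le.1 (hB (X n ω))
    have h3 := abs_le.1 (hB (X 0 ω))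
    rw [abs_le]
    constructor <;> linarith
  have := (hω.sub hbdd).add_const μ
  rw [sub_zero, zero_add] at this
  refine this.congr' ?_
  filter_upwards [eventually_ne_atTop 0] with n hn
  have hn' : (n : ℝ) ≠ 0 := Nat.cast_ne_zero.2 hn
  rw [hsum]
  field_simp
  ring

end Play

/-! ### Existence of plays -/

section Existence

variable {N : ℕ} {p : Fin 3 → ℝ} {γ : ℝ}

/-- The state after `n` turns when the instructions `ω` are followed: `ω none` contains the initial
state, and `ω (some (n, x))` is the outcome, next state and profit, of turn `n` if it starts from
`x`. -/
def drivenState (ω : Option (ℕ × State N) → State N × ℤ) : ℕ → State N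
  | 0 => (ω none).1
  | n + 1 => (ω (some (n, drivenState ω n))).1

/-- The profit of turn `n` when the instructions `ω` are followed. -/
def drivenProfit (ω : Option (ℕ × State N) → State N × ℤ) (n : ℕ) : ℤ :=
  (ω (some (n, drivenState ω n))).2

/-- The driven play follows a given path if and only if the instructions along that path, which
have distinct indices, are the prescribed ones. -/
lemma drivenState_eq_iff (n : ℕ) (x : ℕ → State N) (w : ℕ → ℤ)
    (ω : Option (ℕ × State N) → State N × ℤ) :
    ((∀ k ≤ n, drivenState ω k = x k) ∧ ∀ k < n, drivenProfit ω k = w k) ↔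
      (ω none).1 = x 0 ∧ ∀ k < n, ω (some (k, x k)) = (x (k + 1), w k) := by
  constructor
  · rintro ⟨hx, hw⟩
    refine ⟨hx 0 (Nat.zero_le n), fun k hk => ?_⟩
    rw [← hx k hk.le, ← hx (k + 1) hk, ← hw k hk]
    rfl
  · rintro ⟨h0, h⟩
    have hx : ∀ k ≤ n, drivenState ω k = x k := by
      intro k hk
      induction k with
      | zero => exact h0
      | succ k ih => rw [drivenState, ih (by omega), h k hk]
    exact ⟨hx, fun k hk => by rw [drivenProfit, hx k hk.le, h k hk]⟩

variable [NeZero N]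

lemma measurable_drivenState (n : ℕ) :
    Measurable fun ω : Option (ℕ × State N) → State N × ℤ => drivenState ω n := by
  induction n with
  | zero => exact (measurable_pi_apply _).fst
  | succ n ih =>
    have hu : Measurable fun a : State N × (Option (ℕ × State N) → State N × ℤ) =>
        (a.2 (some (n, a.1))).1 :=
      measurable_from_prod_countable_right fun x => (measurable_pi_apply (some (n, x))).fst
    exact hu.comp (ih.prodMk measurable_id)

lemma measurable_drivenProfit (n : ℕ) :
    Measurable fun ω : Option (ℕ × State N) → State N × ℤ => drivenProfit ω n := by
  have hu : Measurable fun a : State N × (Option (ℕ × State N) → State N × ℤ) =>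
      (a.2 (some (n, a.1))).2 :=
    measurable_from_prod_countable_right fun x => (measurable_pi_apply (some (n, x))).snd
  exact hu.comp ((measurable_drivenState n).prodMk measurable_id)

/-- The distribution of each instruction: the initial state has distribution `ν` (and comes with a
dummy profit `0`), and turn `n` from state `x` has the law of a turn from `x`. -/
noncomputable def instructionLaw (p : Fin 3 → ℝ) (γ : ℝ) (ν : State N → ℝ) :
    Option (ℕ × State N) → Measure (State N × ℤ)
  | none => ∑ x, ENNReal.ofReal (ν x) • Measure.dirac (x, 0)
  | some a => turnLaw p γ a.2

lemma isProbabilityMeasure_instructionLaw (hp : ∀ m, p m ∈ Set.Icc (0 : ℝ) 1)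
    (hγ : γ ∈ Set.Ioo (0 : ℝ) 1) {ν : State N → ℝ} (hν : ν ∈ stdSimplex ℝ (State N))
    (i : Option (ℕ × State N)) : IsProbabilityMeasure (instructionLaw p γ ν i) := by
  cases i with
  | none =>
    constructor
    simp only [instructionLaw, Measure.finsetSum_apply, Measure.smul_apply, measure_univ,
      smul_eq_mul, mul_one]
    rw [← ENNReal.ofReal_sum_of_nonneg fun x _ => hν.1 x, hν.2, ENNReal.ofReal_one]
  | some a => exact isProbabilityMeasure_turnLaw hp hγ _

/-- The probability of a path of the driven play. -/
lemma infinitePi_driven {ν : State N → ℝ}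
    [∀ i, IsProbabilityMeasure (instructionLaw p γ ν i)]
    (n : ℕ) (x : ℕ → State N) (w : ℕ → ℤ) :
    Measure.infinitePi (instructionLaw p γ ν)
        {ω | (∀ k ≤ n, drivenState ω k = x k) ∧ ∀ k < n, drivenProfit ω k = w k} =
      ENNReal.ofReal (ν (x 0)) *
        ∏ k ∈ Finset.range n, ENNReal.ofReal (turnProb p γ (x k) (x (k + 1)) (w k)) := by
  classical
  set t : Option (ℕ × State N) → Set (State N × ℤ) := fun i =>
    i.elim {a | a.1 = x 0} fun k => {(x (k.1 + 1), w k.1)} with ht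
  have hset : {ω : Option (ℕ × State N) → State N × ℤ |
      (∀ k ≤ n, drivenState ω k = x k) ∧ ∀ k < n, drivenProfit ω k = w k} =
      Set.pi (Finset.insertNone ((Finset.range n).image fun k => (k, x k))) t := by
    ext ω
    rw [Set.mem_ofPred_eq, drivenState_eq_iff]
    simp [Set.mem_pi, Option.forall, ht]
  have hnone : instructionLaw p γ ν none {a | a.1 = x 0} = ENNReal.ofReal (ν (x 0)) := by
    simp [instructionLaw, Measure.finsetSum_apply, Set.indicator_apply]
  rw [hset, Measure.infinitePi_pi _ fun i _ => (Set.to_countable _).measurableSet,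
    Finset.prod_insertNone, Finset.prod_image fun a _ b _ hab => congrArg Prod.fst hab]
  simp only [ht, Option.elim, hnone]
  simp only [instructionLaw, turnLaw_singleton]

theorem exists_isPlay (hp : ∀ m, p m ∈ Set.Icc (0 : ℝ) 1) (hγ : γ ∈ Set.Ioo (0 : ℝ) 1)
    {ν : State N → ℝ} (hν : ν ∈ stdSimplex ℝ (State N)) :
    ∃ (Ω : Type) (_ : MeasurableSpace Ω) (P : Measure Ω) (_ : IsProbabilityMeasure P)
      (X : ℕ → Ω → State N) (W : ℕ → Ω → ℤ),
      IsPlay p γ P X W ∧ ∀ x, P.real {ω | X 0 ω = x} = ν x := by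
  have := isProbabilityMeasure_instructionLaw hp hγ hν
  refine ⟨Option (ℕ × State N) → State N × ℤ, inferInstance,
    Measure.infinitePi (instructionLaw p γ ν), inferInstance, fun n ω => drivenState ω n,
    fun n ω => drivenProfit ω n, ⟨measurable_drivenState, measurable_drivenProfit, ?_⟩, ?_⟩
  · intro n x w
    rw [measureReal_def, measureReal_def, infinitePi_driven, infinitePi_driven,
      Finset.prod_range_succ, ← mul_assoc, ENNReal.toReal_mul,
      ENNReal.toReal_ofReal (turnProb_nonneg hp hγ _ _ _)]
  · intro x
    have h := infinitePi_driven (p := p) (γ := γ) (ν := ν) 0 (fun _ => x) 0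
    simp only [Nat.le_zero, forall_eq, Nat.not_lt_zero, false_imp_iff, implies_true, and_true,
      Finset.range_zero, Finset.prod_empty, mul_one] at h
    rw [measureReal_def, h, ENNReal.toReal_ofReal (hν.1 x)]

end Existence

end Parrondo

theorem mainTheorem2 (N : ℕ) [NeZero N] (hN : 3 ≤ N) (p : Fin 3 → ℝ)
    (hp : ∀ m, p m ∈ Set.Icc (0 : ℝ) 1) (γ : ℝ) (hγ : γ ∈ Set.Ioo (0 : ℝ) 1) :
    (Parrondo.IsLumpable (Parrondo.matA N) ∧ Parrondo.IsLumpable (Parrondo.matB N p) ∧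
      Parrondo.IsLumpable (Parrondo.dotB N p)) ∧
    ∃ (μ : ℝ) (π : Parrondo.State N → ℝ) (πbar : Parrondo.RState N → ℝ),
      Parrondo.IsUniqueStationary (Parrondo.matC N p γ) π ∧
      Parrondo.IsUniqueStationary (Parrondo.matCbar N p γ) πbar ∧
      Parrondo.IsMeanProfit N p γ μ ∧
      μ = π ⬝ᵥ (Parrondo.dotC N p γ *ᵥ 1) ∧
      π ⬝ᵥ (Parrondo.dotC N p γ *ᵥ 1) = πbar ⬝ᵥ (Parrondo.dotCbar N p γ *ᵥ 1) := by
  classical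
  open Parrondo in
  have hA : IsLumpable (matA N) := isLumpable_matA
  have hB : IsLumpable (matB N p) := isLumpable_matBpq _ _
  have hdB : IsLumpable (dotB N p) := isLumpable_matBpq _ _
  have hC : IsLumpable (matC N p γ) := hA.lincomb hB _ _
  have hdA : IsLumpable (dotA N) := fun x x' _ b => by simp [classSum, dotA]
  have hdC : IsLumpable (dotC N p γ) := hdA.lincomb hdB _ _
  have hCbar : matCbar N p γ = reduced (matC N p γ) := (reduced_lincomb _ _ _ _).symm
  have hdCbar : dotCbar N p γ = reduced (dotC N p γ) := (reduced_lincomb _ _ _ _).symm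
  have hsto := matC_mem_rowStochastic (N := N) hp hγ
  have hz := matC_reachable hp hγ (by omega : 2 ≤ N)
  obtain ⟨π, hπ⟩ := exists_isStationary hsto
  obtain ⟨g, hg⟩ := exists_poisson hsto hz hπ (dotC N p γ *ᵥ 1)
  refine ⟨⟨hA, hB, hdB⟩, π ⬝ᵥ (dotC N p γ *ᵥ 1), π, classMass π,
    ⟨hπ, fun π' hπ' => hπ'.eq hsto hz hπ⟩, ?_, ⟨?_, ?_, ?_⟩, rfl, ?_⟩
  · rw [hCbar]
    exact ⟨hπ.classMass hC, fun π' hπ' => hπ'.eq (reduced_mem_rowStochastic hsto)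
      (reduced_reachable hsto hC hz) (hπ.classMass hC)⟩
  · exact fun ν hν => exists_isPlay hp hγ hν
  · exact fun Ω _ P _ X W h => h.ae_tendsto hp hγ hg
  · intro Ω _ P _ X W h hX n
    refine ⟨h.integrable_profit hp hγ n, ?_⟩
    rw [h.integral_profit hp hγ n, ← (h.isStationary hp hγ hX).eq hsto hz hπ]
    simp only [hX n]
  · rw [hdCbar, classMass_dotProduct_reduced hdC]
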